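/- Let $N\ge 1$, let $p\ge 1$ divide $N$, and let $0=t_0<t_1<\dots<t_N=T$. Let $(\Omega,\mathcal A,\mathbb P)$ be a probability space carrying a standard $d$-dimensional Brownian motion $W$ on $[0,T]$. Let $r\in\mathbb R$, $\mu\in\mathbb R^d$ and $\sigma\in\mathbb R^{d\times d}$ be constant, with $\sigma$ invertible and rows $\sigma^1,\dots,\sigma^d$. The risk-free asset satisfies $S^0_0>0$ and $\log(S^0_{n+1}/S^0_n)=r(t_{n+1}-t_n)$. The risky assets satisfy $S^i_0>0$ and $$\log\frac{S^i_{n+1}}{S^i_n}=\Big(\mu^i-\tfrac12|\sigma^i|^2\Big)(t_{n+1}-t_n)+\sigma^i\cdot(W_{t_{n+1}}-W_{t_n}),\qquad 1\le i\le d,\ 0\le n<N.$$ Put $\tilde S=S/S^0$, and let $$\mathcal G_n=\sigma\big(W_{t_k}-W_{t_{k-1}}:1\le k\le n\big),\qquad \mathcal F_n=\sigma\big(W_{t_{kp}}-W_{t_{(k-1)p}}:1\le k\le\lfloor n/p\rfloor\big)$$ be the fine and the coarse filtration. Let $V_0>0$ (initial wealth), $\nu\ge 0$ (proportional cost) and $\gamma>0$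 (risk aversion). A control is a family $\alpha=(\alpha_n)_{0\le n\le N}$ of $\mathbb R^d$-valued random variables, $\alpha_n$ being the position held on $(t_{n-1},t_n]$, such that $\alpha_0=0$ and trading takes place only every $p$ steps, i.e. $\alpha_{n+1}=\alpha_n$ whenever $1\le n<N$ and $p\nmid n$. It is $\mathcal G$-predictable (resp. $\mathcal F$-predictable) if $\alpha_n$ is $\mathcal G_{n-1}$-measurable (resp. $\mathcal F_{n-1}$-measurable) for $1\le n\le N$. Put $\tilde X_0=V_0$, $\mathcal C_0=0$ and $$\tilde X_{n+1}=\tilde X_n+\alpha_{n+1}\cdot(\tilde S_{n+1}-\tilde S_n),\qquad \mathcal C_{n+1}=\mathcal C_n+\sum_{i=1}^d\nu\,\frac{|\alpha^i_{n+1}-\alpha^i_n|\,S^i_n}{S^0_n}.$$ The control is admissible if $\tilde X_N-\mathcal C_N\in L^2(\mathbb P)$, and then $$J(\alpha)=\mathbb E_{\mathbb P}\Big[(\tilde X_N-\mathcal C_N)S^0_N-\gamma\Big(\big(\tilde X_N-\mathcal C_N-\mathbb E_{\mathbb P}[\tilde X_N-\mathcal C_N]\big)S^0_N\Big)^2\Big].$$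 A solution of the fine-grid problem is an admissible $\mathcal G$-predictable control that maximizes $J$ over all admissible $\mathcal G$-predictable controls. Then: 1. For every admissible $\mathcal G$-predictable control $\alpha$ there is an admissible $\mathcal F$-predictable control $\beta$ with $J(\beta)\ge J(\alpha)$; thus restricting to the coarse filtration loses nothing. 2. If the fine-grid problem has a solution, then it has a solution $\alpha^\star$ such that $\alpha^\star_n$ is $\mathcal F_{n-1}$-measurable for all $1\le n\le N$. 3. The optimal control is coarse whenever it is determined: let $\alpha^\star$ be any solution and $1\le n\le N$, and suppose that any two $\mathcal F$-predictable solutions have $\mathbb P$-almost surely the same $n$-th component (for example, because the solution is almost surely unique). Then $\alpha^\star_n$ is $\mathbb P$-almost surely equal to an $\mathcal F_{n-1}$-measurable random variable. -/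

import Mathlib

open MeasureTheory ProbabilityTheory
open scoped NNReal

noncomputable section

namespace MeanVarCosts

/-- `W` is a standard `d`-dimensional Brownian motion on `[0, T]` under `P`. -/
structure IsBrownianOn {Ω : Type*} [MeasurableSpace Ω] {d : ℕ} (T : ℝ≥0)
    (W : ℝ≥0 → Ω → (Fin d → ℝ)) (P : Measure Ω) : Prop where
  measurable : ∀ t ≤ T, Measurable (W t)
  start_zero : ∀ᵐ ω ∂P, W 0 ω = 0
  indep_increments : ∀ (m : ℕ) (τ : Fin (m + 1) → ℝ≥0), Monotone τ → (∀ k, τ k ≤ T) →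
    iIndepFun (fun (k : Fin m) ω => W (τ k.succ) ω - W (τ k.castSucc) ω) P
  law_increment : ∀ s t : ℝ≥0, s ≤ t → t ≤ T →
    P.map (fun ω => W t ω - W s ω) = Measure.pi (fun _ : Fin d => gaussianReal 0 (t - s))
  continuous_paths : ∀ᵐ ω ∂P, ContinuousOn (fun t => W t ω) (Set.Icc 0 T)

/-- Black–Scholes type market with `d` risky assets, constant coefficients, and a time grid
`0 = t 0 < t 1 < ⋯ < t N`. The `i`-th row of `sigma` is the volatility vector of asset `i`. -/
structure Market (d N : ℕ) where
  /-- grid dates; only `t 0, …, t N` matter -/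
  t : ℕ → ℝ≥0
  t_zero : t 0 = 0
  t_lt : ∀ n < N, t n < t (n + 1)
  /-- risk free rate -/
  r : ℝ
  /-- drifts of the risky assets -/
  mu : Fin d → ℝ
  /-- volatility matrix -/
  sigma : Matrix (Fin d) (Fin d) ℝ
  sigma_invertible : IsUnit sigma.det
  /-- initial price of the risk free asset -/
  bond0 : ℝ
  bond0_pos : 0 < bond0
  /-- initial prices of the risky assets -/
  price0 : Fin d → ℝ
  price0_pos : ∀ i, 0 < price0 i

namespace Market

variable {Ω : Type*} {d N : ℕ}

/-- Risk free asset `S⁰ₙ`: `log (S⁰ₙ₊₁ / S⁰ₙ) = r (tₙ₊₁ - tₙ)`. -/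
def bond (M : Market d N) : ℕ → ℝ
  | 0 => M.bond0
  | n + 1 => M.bond n * Real.exp (M.r * ((M.t (n + 1) : ℝ) - (M.t n : ℝ)))

/-- Risky assets `Sₙⁱ`:
`log (Sⁱₙ₊₁ / Sⁱₙ) = (μⁱ - |σⁱ|² / 2) (tₙ₊₁ - tₙ) + σⁱ · (W_{tₙ₊₁} - W_{tₙ})`. -/
def price (M : Market d N) (W : ℝ≥0 → Ω → (Fin d → ℝ)) : ℕ → Ω → (Fin d → ℝ)
  | 0, _ => M.price0
  | n + 1, ω => fun i => M.price W n ω i *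
      Real.exp ((M.mu i - (∑ j, M.sigma i j ^ 2) / 2) * ((M.t (n + 1) : ℝ) - (M.t n : ℝ))
        + ∑ j, M.sigma i j * (W (M.t (n + 1)) ω j - W (M.t n) ω j))

/-- Discounted risky assets. -/
def discPrice (M : Market d N) (W : ℝ≥0 → Ω → (Fin d → ℝ)) (n : ℕ) (ω : Ω) (i : Fin d) : ℝ :=
  M.price W n ω i / M.bond n

/-- `Gₙ`, generated by the increments of `W` over the first `n` steps of the fine grid. -/
@[reducible] def fineFiltration (M : Market d N) (W : ℝ≥0 → Ω → (Fin d → ℝ)) (n : ℕ) :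
    MeasurableSpace Ω :=
  ⨆ k : Fin n, MeasurableSpace.comap
    (fun ω => W (M.t (k + 1)) ω - W (M.t k) ω) MeasurableSpace.pi

/-- `Fₙ`, generated by the increments of `W` over the first `⌊n / p⌋` steps of the coarse grid
`t 0, t p, t (2p), …`. -/
@[reducible] def coarseFiltration (M : Market d N) (W : ℝ≥0 → Ω → (Fin d → ℝ)) (p n : ℕ) :
    MeasurableSpace Ω :=
  ⨆ k : Fin (n / p), MeasurableSpace.comap
    (fun ω => W (M.t ((k + 1) * p)) ω - W (M.t (k * p)) ω) MeasurableSpace.pi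

/-- Gain process before costs: `X̃₀ = V₀`, `X̃ₙ₊₁ = X̃ₙ + αₙ₊₁ · (S̃ₙ₊₁ - S̃ₙ)`. -/
def gain (M : Market d N) (W : ℝ≥0 → Ω → (Fin d → ℝ)) (V₀ : ℝ) (α : ℕ → Ω → (Fin d → ℝ)) :
    ℕ → Ω → ℝ
  | 0, _ => V₀
  | n + 1, ω => M.gain W V₀ α n ω
      + ∑ i, α (n + 1) ω i * (M.discPrice W (n + 1) ω i - M.discPrice W n ω i)

/-- Discounted cumulative proportional transaction costs. -/
def cost (M : Market d N) (W : ℝ≥0 → Ω → (Fin d → ℝ)) (ν : ℝ) (α : ℕ → Ω → (Fin d → ℝ)) :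
    ℕ → Ω → ℝ
  | 0, _ => 0
  | n + 1, ω => M.cost W ν α n ω
      + ∑ i, ν * (|α (n + 1) ω i - α n ω i| * M.price W n ω i / M.bond n)

/-- Discounted terminal wealth `X̃_N - C_N`. -/
def terminalWealth (M : Market d N) (W : ℝ≥0 → Ω → (Fin d → ℝ)) (V₀ ν : ℝ)
    (α : ℕ → Ω → (Fin d → ℝ)) (ω : Ω) : ℝ :=
  M.gain W V₀ α N ω - M.cost W ν α N ω

/-- `α` is a holding process with no initial risky position, predictable for `𝓗`, which is
re-balanced only at the dates `t 0, t p, t (2p), …`. Here `α n` is the position held on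
`(t (n-1), t n]`, so it changes between `n` and `n + 1` only if `p ∣ n`. -/
structure IsControl (N : ℕ) (p : ℕ) (𝓗 : ℕ → MeasurableSpace Ω) (α : ℕ → Ω → (Fin d → ℝ)) :
    Prop where
  start_zero : ∀ ω, α 0 ω = 0
  predictable : ∀ n, 1 ≤ n → n ≤ N → Measurable[𝓗 (n - 1)] (α n)
  no_trade : ∀ n, 1 ≤ n → n < N → ¬ p ∣ n → ∀ ω, α (n + 1) ω = α n ω

variable [MeasurableSpace Ω]

/-- Admissible controls: those whose terminal wealth is square integrable, so that the
mean-variance criterion is meaningful. -/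
structure IsAdmissible (M : Market d N) (W : ℝ≥0 → Ω → (Fin d → ℝ)) (P : Measure Ω) (V₀ ν : ℝ)
    (p : ℕ) (𝓗 : ℕ → MeasurableSpace Ω) (α : ℕ → Ω → (Fin d → ℝ)) : Prop where
  isControl : IsControl N p 𝓗 α
  memLp : MemLp (M.terminalWealth W V₀ ν α) 2 P

/-- Mean-variance criterion
`E[(X̃_N - C_N) S⁰_N - γ ((X̃_N - C_N - E[X̃_N - C_N]) S⁰_N)²]`. -/
def objective (M : Market d N) (W : ℝ≥0 → Ω → (Fin d → ℝ)) (P : Measure Ω) (V₀ ν γ : ℝ)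
    (α : ℕ → Ω → (Fin d → ℝ)) : ℝ :=
  ∫ ω, (M.terminalWealth W V₀ ν α ω * M.bond N
    - γ * ((M.terminalWealth W V₀ ν α ω - ∫ ω', M.terminalWealth W V₀ ν α ω' ∂P)
        * M.bond N) ^ 2) ∂P

/-- `α` solves the fine-grid problem: it maximizes the criterion over all admissible controls
that are predictable for the fine filtration. -/
structure IsSolution (M : Market d N) (W : ℝ≥0 → Ω → (Fin d → ℝ)) (P : Measure Ω)
    (V₀ ν γ : ℝ) (p : ℕ) (α : ℕ → Ω → (Fin d → ℝ)) : Prop where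
  admissible : M.IsAdmissible W P V₀ ν p (M.fineFiltration W) α
  optimal : ∀ β : ℕ → Ω → (Fin d → ℝ), M.IsAdmissible W P V₀ ν p (M.fineFiltration W) β →
    M.objective W P V₀ ν γ β ≤ M.objective W P V₀ ν γ α

end Market

end MeanVarCosts

end

/-! Trading happens at coarse dates only, so terminal wealth depends on the positions and on the
coarse increments `Z`; the finer noise enters only through the positions. Subtracting from each fine
increment its time-proportional share of the coarse increment leaves a bridge `B`. Sums and bridges
are jointly Gaussian and uncorrelated, hence independent (`indepFun_blockSum_blockBridge`). A fine
control is therefore a coarse control randomized by the independent variable `B`.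

Freezing `B = b` gives a coarse control. Means average out exactly, while by the law of total
variance the average of the frozen variances is at most the full variance, so the criterion does not
decrease on average over `b` (`meanVar_prod_le`, `exists_coarse_randomization`). Some `b` thus does
at least as well as the fine control. If the fine control is optimal, no `b` does better, so almost
every `b` gives a coarse solution. Uniqueness of a component then makes it independent of `b`, and
Fubini transfers this to the original control. -/

noncomputable section

namespace MeanVarCosts

/-! ### Independence of Gaussian block sums and bridges. -/

section GaussianBridge

set_option linter.unusedSectionVars false

variable {Ω ι κ δ : Type*} [MeasurableSpace Ω] {P : Measure Ω} [IsProbabilityMeasure P]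
  [Fintype ι] [Fintype κ] [Fintype δ] [DecidableEq ι] [DecidableEq κ] [DecidableEq δ]

/-- Sums of a family of vectors over the blocks of a partition. -/
def blockSum (blk : ι → κ) (x : ι → δ → ℝ) (q : κ × δ) : ℝ :=
  ∑ k, if blk k = q.1 then x k q.2 else 0

/-- Share of the `k`-th weight in the total weight of its block. -/
def blockRatio (blk : ι → κ) (v : ι → ℝ) (k : ι) : ℝ :=
  v k / ∑ l, if blk l = blk k then v l else 0

/-- Discrete bridge: a family of vectors minus the weighted share of their block sums. -/
def blockBridge (blk : ι → κ) (v : ι → ℝ) (x : ι → δ → ℝ) (q : ι × δ) : ℝ :=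
  x q.1 q.2 - blockRatio blk v q.1 * blockSum blk x (blk q.1, q.2)

/-- Block sums and bridges as a linear map. -/
def blockSplit (blk : ι → κ) (v : ι → ℝ) :
    (ι → δ → ℝ) →ₗ[ℝ] (κ × δ → ℝ) × (ι × δ → ℝ) where
  toFun x := (blockSum blk x, blockBridge blk v x)
  map_add' x y := by
    have h : ∀ q, blockSum blk (x + y) q = blockSum blk x q + blockSum blk y q := by
      intro q
      simp only [blockSum, ← Finset.sum_add_distrib]
      exact Finset.sum_congr rfl fun k _ => by split_ifs <;> simp
    ext q
    · exact h q
    · simp only [blockBridge, h, Pi.add_apply, Prod.snd_add]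
      ring
  map_smul' c x := by
    have h : ∀ q, blockSum blk (c • x) q = c * blockSum blk x q := by
      intro q
      simp only [blockSum, Finset.mul_sum]
      exact Finset.sum_congr rfl fun k _ => by split_ifs <;> simp
    ext q
    · exact h q
    · simp only [blockBridge, h, Pi.smul_apply, Prod.smul_snd, smul_eq_mul, RingHom.id_apply]
      ring

variable {X : ι → Ω → δ → ℝ} {v : ι → ℝ≥0}

lemma map_coord_eq_gaussianReal (hX : ∀ k, Measurable (X k))
    (hlaw : ∀ k, P.map (X k) = Measure.pi fun _ => gaussianReal 0 (v k)) (k : ι) (a : δ) :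
    P.map (fun ω => X k ω a) = gaussianReal 0 (v k) := by
  have h := (measurePreserving_eval (fun _ : δ => gaussianReal 0 (v k)) a).map_eq
  rw [← hlaw k, Measure.map_map (measurable_pi_apply a) (hX k)] at h
  exact h

lemma hasGaussianLaw_coord (hX : ∀ k, Measurable (X k))
    (hlaw : ∀ k, P.map (X k) = Measure.pi fun _ => gaussianReal 0 (v k)) (k : ι) (a : δ) :
    HasGaussianLaw (fun ω => X k ω a) P := by
  refine ⟨?_⟩
  rw [map_coord_eq_gaussianReal hX hlaw]
  infer_instance

lemma iIndepFun_coord (hX : ∀ k, Measurable (X k))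
    (hlaw : ∀ k, P.map (X k) = Measure.pi fun _ => gaussianReal 0 (v k)) (k : ι) :
    iIndepFun (fun a ω => X k ω a) P := by
  rw [iIndepFun_iff_map_fun_eq_pi_map (f := fun a ω => X k ω a)
    fun a => ((measurable_pi_apply a).comp (hX k)).aemeasurable]
  simp only [map_coord_eq_gaussianReal hX hlaw]
  exact hlaw k

/-- Joint Gaussianity is what lets zero covariance imply independence. Independence is used twice:
among the coordinates of a vector, then among the vectors. -/
lemma hasGaussianLaw_family (hX : ∀ k, Measurable (X k)) (hind : iIndepFun X P)
    (hlaw : ∀ k, P.map (X k) = Measure.pi fun _ => gaussianReal 0 (v k)) :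
    HasGaussianLaw (fun ω k => X k ω) P :=
  iIndepFun.hasGaussianLaw
    (fun k => iIndepFun.hasGaussianLaw (X := fun a ω => X k ω a)
      (hasGaussianLaw_coord hX hlaw k) (iIndepFun_coord hX hlaw k)) hind

lemma covariance_coord (hX : ∀ k, Measurable (X k)) (hind : iIndepFun X P)
    (hlaw : ∀ k, P.map (X k) = Measure.pi fun _ => gaussianReal 0 (v k)) (k l : ι) (a e : δ) :
    cov[fun ω => X k ω a, fun ω => X l ω e; P] = if k = l ∧ a = e then (v k : ℝ) else 0 := by
  have hL := fun k a => (hasGaussianLaw_coord hX hlaw k a).memLp_two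
  by_cases hkl : k = l
  · subst hkl
    by_cases hae : a = e
    · subst hae
      have hm : Measurable fun ω => X k ω a := (measurable_pi_apply a).comp (hX k)
      rw [covariance_self hm.aemeasurable]
      simp only [and_self, if_true]
      rw [← variance_id_gaussianReal (μ := 0) (v := v k), ← map_coord_eq_gaussianReal hX hlaw k a,
        variance_id_map hm.aemeasurable]
    · rw [((iIndepFun_coord hX hlaw k).indepFun hae).covariance_eq_zero (hL k a) (hL k e)]
      simp [hae]
  · have h := (hind.indepFun hkl).comp (measurable_pi_apply a) (measurable_pi_apply e)
    rw [IndepFun.covariance_eq_zero (X := fun ω => X k ω a) (Y := fun ω => X l ω e) h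
      (hL k a) (hL l e)]
    simp [hkl]

lemma memLp_blockSum (hX : ∀ k, Measurable (X k))
    (hlaw : ∀ k, P.map (X k) = Measure.pi fun _ => gaussianReal 0 (v k)) (blk : ι → κ)
    (q : κ × δ) : MemLp (fun ω => blockSum blk (fun k => X k ω) q) 2 P := by
  refine memLp_finsetSum _ fun k _ => ?_
  split_ifs
  · exact (hasGaussianLaw_coord hX hlaw k q.2).memLp_two
  · exact MemLp.zero

lemma covariance_blockSum_coord (hX : ∀ k, Measurable (X k)) (hind : iIndepFun X P)
    (hlaw : ∀ k, P.map (X k) = Measure.pi fun _ => gaussianReal 0 (v k)) (blk : ι → κ)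
    (q : κ × δ) (k : ι) (a : δ) :
    cov[fun ω => blockSum blk (fun k => X k ω) q, fun ω => X k ω a; P]
      = if blk k = q.1 ∧ q.2 = a then (v k : ℝ) else 0 := by
  unfold blockSum
  rw [covariance_fun_sum_left (X := fun l ω => if blk l = q.1 then X l ω q.2 else 0) _
    (hasGaussianLaw_coord hX hlaw k a).memLp_two]
  · rw [Finset.sum_eq_single k]
    · by_cases h : blk k = q.1
      · simp only [h, if_true, true_and]
        rw [covariance_coord hX hind hlaw]
        simp
      · simp only [h, if_false, false_and]
        exact covariance_const_left 0
    · intro l _ hl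
      by_cases h : blk l = q.1
      · simp only [h, if_true]
        rw [covariance_coord hX hind hlaw]
        simp [hl]
      · simp only [h, if_false]
        exact covariance_const_left 0
    · simp
  · intro l
    split_ifs
    · exact (hasGaussianLaw_coord hX hlaw l q.2).memLp_two
    · exact MemLp.zero

lemma covariance_blockSum_blockSum (hX : ∀ k, Measurable (X k)) (hind : iIndepFun X P)
    (hlaw : ∀ k, P.map (X k) = Measure.pi fun _ => gaussianReal 0 (v k)) (blk : ι → κ)
    (q q' : κ × δ) :
    cov[fun ω => blockSum blk (fun k => X k ω) q, fun ω => blockSum blk (fun k => X k ω) q'; P]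
      = if q = q' then ∑ k, (if blk k = q.1 then (v k : ℝ) else 0) else 0 := by
  conv_lhs => arg 2; unfold blockSum
  rw [covariance_fun_sum_right (X := fun l ω => if blk l = q'.1 then X l ω q'.2 else 0) _
    (memLp_blockSum hX hlaw blk q)]
  · have hterm : ∀ l, cov[fun ω => blockSum blk (fun k => X k ω) q,
        fun ω => if blk l = q'.1 then X l ω q'.2 else 0; P]
        = if q = q' then (if blk l = q.1 then (v l : ℝ) else 0) else 0 := by
      intro l
      by_cases h : blk l = q'.1
      · simp only [h, if_true]
        rw [covariance_blockSum_coord hX hind hlaw, h]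
        simp only [Prod.ext_iff]
        split_ifs <;> grind
      · simp only [h, if_false]
        rw [covariance_const_right]
        split_ifs <;> grind
    simp only [hterm]
    split_ifs <;> simp
  · intro l
    split_ifs
    · exact (hasGaussianLaw_coord hX hlaw l q'.2).memLp_two
    · exact MemLp.zero

/-- Block sums of independent centred Gaussian vectors are independent of the bridges. -/
theorem indepFun_blockSum_blockBridge (hX : ∀ k, Measurable (X k)) (hind : iIndepFun X P)
    (hlaw : ∀ k, P.map (X k) = Measure.pi fun _ => gaussianReal 0 (v k)) (hv : ∀ k, 0 < v k)
    (blk : ι → κ) :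
    IndepFun (fun ω => blockSum blk fun k => X k ω)
      (fun ω => blockBridge blk (fun k => (v k : ℝ)) fun k => X k ω) P := by
  refine HasGaussianLaw.indepFun_of_covariance_eval
    (X := fun q ω => blockSum blk (fun k => X k ω) q)
    (Y := fun q ω => blockBridge blk (fun k => (v k : ℝ)) (fun k => X k ω) q) ?_ ?_
  -- Sums and bridges together are a linear image of the Gaussian family.
  · exact (hasGaussianLaw_family hX hind hlaw).map_fun
      (blockSplit blk fun k => (v k : ℝ)).toContinuousLinearMap
  · intro q q'
    unfold blockBridge
    rw [covariance_fun_sub_right (memLp_blockSum hX hlaw blk q)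
      (hasGaussianLaw_coord hX hlaw q'.1 q'.2).memLp_two
      ((memLp_blockSum hX hlaw blk _).const_mul _), covariance_const_mul_right,
      covariance_blockSum_coord hX hind hlaw, covariance_blockSum_blockSum hX hind hlaw]
    -- `blockRatio` is the regression coefficient on the block sum: the covariance is the weight `v
    -- k` minus the ratio times the total block weight, which cancels because that total is
    -- positive.
    by_cases h : blk q'.1 = q.1 ∧ q.2 = q'.2
    · have hq : q = (blk q'.1, q'.2) := Prod.ext h.1.symm h.2
      rw [if_pos h, if_pos hq, blockRatio, ← h.1, div_mul_cancel₀, sub_self]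
      refine ne_of_gt (Finset.sum_pos' (fun l _ => ?_) ⟨q'.1, Finset.mem_univ _, ?_⟩)
      · split_ifs <;> simp
      · simpa using hv q'.1
    · have hq : q ≠ (blk q'.1, q'.2) := fun hq => h ⟨by rw [hq], by rw [hq]⟩
      rw [if_neg h, if_neg hq]
      simp

end GaussianBridge

/-! ### Wealth as a function of the coarse increments. -/

namespace Market

variable {Ω : Type*} {d N : ℕ}

/-- Increment of `W` over the `k`-th step of the fine grid. -/
def fineIncr (M : Market d N) (W : ℝ≥0 → Ω → (Fin d → ℝ)) (k : ℕ) (ω : Ω) : Fin d → ℝ :=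
  W (M.t (k + 1)) ω - W (M.t k) ω

/-- Increment of `W` over the `j`-th step of the coarse grid. -/
def coarseIncr (M : Market d N) (W : ℝ≥0 → Ω → (Fin d → ℝ)) (p j : ℕ) (ω : Ω) : Fin d → ℝ :=
  W (M.t ((j + 1) * p)) ω - W (M.t (j * p)) ω

/-- Price of asset `i` at the `j`-th coarse date as a function of the coarse increments. -/
def coarsePrice (M : Market d N) (p : ℕ) (z : ℕ → Fin d → ℝ) (j : ℕ) (i : Fin d) : ℝ :=
  M.price0 i * Real.exp ((M.mu i - (∑ a, M.sigma i a ^ 2) / 2) * (M.t (j * p) : ℝ)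
    + ∑ a, M.sigma i a * ∑ l ∈ Finset.range j, z l a)

/-- Discounted terminal wealth as a function of the positions and the coarse increments. -/
def coarseWealth (M : Market d N) (p : ℕ) (V₀ ν : ℝ) (K : ℕ) (a z : ℕ → Fin d → ℝ) : ℝ :=
  V₀ + ∑ j ∈ Finset.range K,
    (∑ i, a (j * p + 1) i * (M.coarsePrice p z (j + 1) i / M.bond ((j + 1) * p)
        - M.coarsePrice p z j i / M.bond (j * p))
      - ∑ i, ν * (|a (j * p + 1) i - a (j * p) i| * M.coarsePrice p z j i / M.bond (j * p)))

variable (M : Market d N) (W : ℝ≥0 → Ω → (Fin d → ℝ))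

lemma t_mono {m n : ℕ} (hmn : m ≤ n) (hn : n ≤ N) : M.t m ≤ M.t n := by
  induction n, hmn using Nat.le_induction with
  | base => exact le_rfl
  | succ n _ ih => exact (ih (by omega)).trans (M.t_lt n (by omega)).le

/-- The increments telescope. Keeping `W (M.t 0)` makes the identity pointwise, since the path
starts at zero only almost surely. -/
lemma price_eq (n : ℕ) (ω : Ω) (i : Fin d) :
    M.price W n ω i = M.price0 i *
      Real.exp ((M.mu i - (∑ a, M.sigma i a ^ 2) / 2) * (M.t n : ℝ)
        + ∑ a, M.sigma i a * (W (M.t n) ω a - W (M.t 0) ω a)) := by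
  induction n with
  | zero => simp [price, M.t_zero]
  | succ n ih =>
    simp only [price]
    rw [ih, mul_assoc, ← Real.exp_add]
    congr 2
    have h : ∑ a, M.sigma i a * (W (M.t (n + 1)) ω a - W (M.t 0) ω a)
        = ∑ a, M.sigma i a * (W (M.t n) ω a - W (M.t 0) ω a)
          + ∑ a, M.sigma i a * (W (M.t (n + 1)) ω a - W (M.t n) ω a) := by
      rw [← Finset.sum_add_distrib]
      exact Finset.sum_congr rfl fun a _ => by ring
    rw [h]
    ring

lemma price_mul_eq_coarsePrice (p j : ℕ) (ω : Ω) (i : Fin d) (z : ℕ → Fin d → ℝ)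
    (hz : ∀ l < j, z l = M.coarseIncr W p l ω) :
    M.price W (j * p) ω i = M.coarsePrice p z j i := by
  rw [price_eq, coarsePrice]
  congr 4 with a
  rw [Finset.sum_congr rfl fun l hl => congrFun (hz l (Finset.mem_range.1 hl)) a]
  simp only [coarseIncr, Pi.sub_apply]
  rw [Finset.sum_range_sub (fun l => W (M.t (l * p)) ω a), zero_mul]

lemma eq_block_start {p n : ℕ} {α : ℕ → Ω → (Fin d → ℝ)}
    (hα : ∀ n, 1 ≤ n → n < N → ¬ p ∣ n → ∀ ω, α (n + 1) ω = α n ω) (hn : n < N)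
    (ω : Ω) : α (n + 1) ω = α (n / p * p + 1) ω := by
  induction n with
  | zero => simp
  | succ n ih =>
    by_cases hd : p ∣ n + 1
    · rw [Nat.div_mul_cancel hd]
    · rw [hα (n + 1) (by omega) hn hd, ih (by omega), Nat.succ_div_of_not_dvd hd]

variable {M W}

lemma gain_within_block {p j m : ℕ} {α : ℕ → Ω → (Fin d → ℝ)} {ω : Ω} (V₀ : ℝ)
    (hα : ∀ m < p, α (j * p + m + 1) ω = α (j * p + 1) ω) (hm : m ≤ p) :
    M.gain W V₀ α (j * p + m) ω = M.gain W V₀ α (j * p) ω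
      + ∑ i, α (j * p + 1) ω i * (M.discPrice W (j * p + m) ω i - M.discPrice W (j * p) ω i) := by
  induction m with
  | zero => simp
  | succ m ih =>
    rw [← add_assoc, gain, ih (by omega), hα m (by omega), add_assoc, ← Finset.sum_add_distrib]
    congr 1
    exact Finset.sum_congr rfl fun i _ => by ring

/-- The first step of a block pays for the whole rebalancing; the later position changes vanish. -/
lemma cost_within_block {p j m : ℕ} {α : ℕ → Ω → (Fin d → ℝ)} {ω : Ω} (ν : ℝ)
    (hα : ∀ m < p, α (j * p + m + 1) ω = α (j * p + 1) ω) (hm : m < p) :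
    M.cost W ν α (j * p + m + 1) ω = M.cost W ν α (j * p) ω
      + ∑ i, ν * (|α (j * p + 1) ω i - α (j * p) ω i| * M.price W (j * p) ω i
        / M.bond (j * p)) := by
  induction m with
  | zero => rfl
  | succ m ih =>
    rw [cost, ← add_assoc, ih (by omega), add_assoc (j * p) m 1, hα (m + 1) hm, ← add_assoc, hα m (by omega)]
    simp

/-- With trading at coarse dates only, terminal wealth depends on the coarse increments only. -/
lemma terminalWealth_eq_coarseWealth {p K : ℕ} (hp : 0 < p) (hK : N = K * p) (V₀ ν : ℝ)
    {α : ℕ → Ω → (Fin d → ℝ)}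
    (hα : ∀ n, 1 ≤ n → n < N → ¬ p ∣ n → ∀ ω, α (n + 1) ω = α n ω) (ω : Ω)
    {a z : ℕ → Fin d → ℝ} (ha : ∀ n ≤ N, a n = α n ω)
    (hz : ∀ l < K, z l = M.coarseIncr W p l ω) :
    M.terminalWealth W V₀ ν α ω = M.coarseWealth p V₀ ν K a z := by
  have key : ∀ j ≤ K, M.gain W V₀ α (j * p) ω - M.cost W ν α (j * p) ω
      = M.coarseWealth p V₀ ν j a z := by
    intro j
    induction j with
    | zero => simp [coarseWealth, gain, cost]
    | succ j ih =>
      intro hj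
      have hjN : (j + 1) * p ≤ N := hK ▸ Nat.mul_le_mul_right p hj
      rw [Nat.succ_mul] at hjN
      have hblock : ∀ m < p, α (j * p + m + 1) ω = α (j * p + 1) ω := by
        intro m hm
        rw [eq_block_start hα (by omega), mul_comm j p, Nat.mul_add_div hp,
          Nat.div_eq_of_lt hm, add_zero, mul_comm]
      have hg := gain_within_block (M := M) (W := W) V₀ hblock le_rfl
      -- Taken at `m = p - 1`, so that `m + 1` is the end of the block.
      have hc := cost_within_block (M := M) (W := W) ν hblock (Nat.sub_lt hp one_pos)
      rw [add_assoc, Nat.sub_add_cancel (Nat.one_le_of_lt hp)] at hc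
      have hih := ih (by omega)
      have hpr := fun i => M.price_mul_eq_coarsePrice W p j ω i z fun l hl => hz l (by omega)
      have hpr' := fun i =>
        M.price_mul_eq_coarsePrice W p (j + 1) ω i z fun l hl => hz l (by omega)
      have hsucc : j * p + p = (j + 1) * p := (Nat.succ_mul j p).symm
      rw [hsucc] at hg hc
      rw [coarseWealth, Finset.sum_range_succ, ← add_assoc]
      rw [coarseWealth] at hih
      rw [← hih, hg, hc, ha _ (by omega), ha _ (by omega)]
      simp only [discPrice, hpr, hpr']
      ring
  rw [terminalWealth, ← key K le_rfl, ← hK]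

lemma measurable_coarseWealth {E : Type*} [MeasurableSpace E] (M : Market d N) (p : ℕ)
    (V₀ ν : ℝ) (K : ℕ) {a z : E → ℕ → Fin d → ℝ} (ha : Measurable a) (hz : Measurable z) :
    Measurable fun x => M.coarseWealth p V₀ ν K (a x) (z x) := by
  have ha' : ∀ n i, Measurable fun x => a x n i := fun n i => by fun_prop
  have hz' : ∀ n i, Measurable fun x => z x n i := fun n i => by fun_prop
  have hS : ∀ j i, Measurable fun x => M.coarsePrice p (z x) j i := fun j i => by
    unfold coarsePrice; fun_prop
  unfold coarseWealth
  fun_prop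

/-- With a single generating map, predictable positions factor through the increments by the
Doob–Dynkin lemma. -/
lemma comap_fineIncr_eq (M : Market d N) (W : ℝ≥0 → Ω → (Fin d → ℝ)) (n : ℕ) :
    M.fineFiltration W n
      = MeasurableSpace.comap (fun ω (k : Fin n) => M.fineIncr W k ω) MeasurableSpace.pi := by
  simp only [fineFiltration, MeasurableSpace.pi, MeasurableSpace.comap_iSup,
    MeasurableSpace.comap_comp]
  rfl

lemma measurable_coarseIncr (M : Market d N) (W : ℝ≥0 → Ω → (Fin d → ℝ)) {p n l : ℕ}
    (hl : l < n / p) : Measurable[M.coarseFiltration W p n] (M.coarseIncr W p l) :=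
  Measurable.mono (comap_measurable _) (le_iSup (fun k : Fin (n / p) => MeasurableSpace.comap
    (fun ω => W (M.t ((k + 1) * p)) ω - W (M.t (k * p)) ω) MeasurableSpace.pi) ⟨l, hl⟩) le_rfl

lemma measurable_fineIncr (M : Market d N) (W : ℝ≥0 → Ω → (Fin d → ℝ)) {n k : ℕ}
    (hk : k < n) : Measurable[M.fineFiltration W n] (M.fineIncr W k) :=
  Measurable.mono (comap_measurable _) (le_iSup (fun k : Fin n => MeasurableSpace.comap
    (fun ω => W (M.t (k + 1)) ω - W (M.t k) ω) MeasurableSpace.pi) ⟨k, hk⟩) le_rfl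

lemma coarseIncr_eq_sum (M : Market d N) (W : ℝ≥0 → Ω → (Fin d → ℝ)) (p j : ℕ) (ω : Ω) :
    M.coarseIncr W p j ω = ∑ k ∈ Finset.Ico (j * p) ((j + 1) * p), M.fineIncr W k ω := by
  simp only [fineIncr, coarseIncr]
  rw [Finset.sum_Ico_eq_sum_range, Nat.succ_mul, Nat.add_sub_cancel_left]
  simpa [add_assoc] using (Finset.sum_range_sub (fun k => W (M.t (j * p + k)) ω) p).symm

lemma coarseFiltration_le_fineFiltration (M : Market d N) (W : ℝ≥0 → Ω → (Fin d → ℝ))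
    (p n : ℕ) : M.coarseFiltration W p n ≤ M.fineFiltration W n := by
  refine iSup_le fun k => ?_
  rw [← measurable_iff_comap_le]
  have h : (fun ω => W (M.t ((k + 1) * p)) ω - W (M.t (k * p)) ω)
      = fun ω => ∑ l ∈ Finset.Ico (k * p) ((k + 1) * p), M.fineIncr W l ω :=
    funext fun ω => M.coarseIncr_eq_sum W p k ω
  rw [h]
  refine Finset.measurable_fun_sum _ fun l hl => M.measurable_fineIncr W ?_
  exact (Finset.mem_Ico.1 hl).2.trans_le
    ((Nat.mul_le_mul_right p k.2).trans (Nat.div_mul_le_self n p))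

end Market

/-! ### The mean-variance criterion under an independent randomization. -/

section MeanVariance

variable {𝓧 𝓩 𝓑 : Type*} [MeasurableSpace 𝓧] [MeasurableSpace 𝓩] [MeasurableSpace 𝓑]

/-- Mean-variance criterion of a terminal payoff `f`, in units of a numéraire worth `s`. -/
def meanVar (s γ : ℝ) (Q : Measure 𝓧) (f : 𝓧 → ℝ) : ℝ :=
  ∫ x, (f x * s - γ * ((f x - ∫ y, f y ∂Q) * s) ^ 2) ∂Q

/-- In terms of first and second moments, the criterion can be handled by Fubini term by term. -/
lemma meanVar_eq {s γ : ℝ} {Q : Measure 𝓧} [IsProbabilityMeasure Q] {f : 𝓧 → ℝ}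
    (hf : MemLp f 2 Q) :
    meanVar s γ Q f
      = s * ∫ x, f x ∂Q - γ * s ^ 2 * (∫ x, f x ^ 2 ∂Q - (∫ x, f x ∂Q) ^ 2) := by
  have hi : Integrable f Q := hf.integrable one_le_two
  have hsq : Integrable (fun x => f x ^ 2) Q := hf.integrable_sq
  unfold meanVar
  set m := ∫ y, f y ∂Q with hm
  have h : ∀ x, f x * s - γ * ((f x - m) * s) ^ 2
      = (s + 2 * γ * s ^ 2 * m) * f x - γ * s ^ 2 * f x ^ 2 - γ * s ^ 2 * m ^ 2 :=
    fun x => by ring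
  simp only [h]
  have hd : Integrable
      (fun x => (s + 2 * γ * s ^ 2 * m) * f x - γ * s ^ 2 * f x ^ 2) Q :=
    (hi.const_mul _).sub (hsq.const_mul _)
  rw [integral_sub hd (integrable_const _), integral_sub (hi.const_mul _) (hsq.const_mul _), integral_const_mul, integral_const_mul,
    integral_const, ← hm]
  simp
  ring

lemma meanVar_map {s γ : ℝ} {Q : Measure 𝓧} {Z : 𝓧 → 𝓩} (hZ : Measurable Z) {f : 𝓩 → ℝ}
    (hf : Measurable f) : meanVar s γ (Q.map Z) f = meanVar s γ Q (fun x => f (Z x)) := by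
  unfold meanVar
  rw [integral_map hZ.aemeasurable hf.aestronglyMeasurable,
    integral_map hZ.aemeasurable (by fun_prop)]

lemma sq_integral_le_integral_sq {Q : Measure 𝓧} [IsProbabilityMeasure Q] {f : 𝓧 → ℝ}
    (hf : MemLp f 2 Q) : (∫ x, f x ∂Q) ^ 2 ≤ ∫ x, f x ^ 2 ∂Q := by
  have h := variance_nonneg f Q
  rw [variance_eq_sub hf] at h
  simpa using h

variable {μ : Measure 𝓩} {ν : Measure 𝓑} [IsProbabilityMeasure μ] [IsProbabilityMeasure ν]
  {H : 𝓩 × 𝓑 → ℝ}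

lemma ae_memLp_section (hH : Measurable H) (hL : MemLp H 2 (μ.prod ν)) :
    ∀ᵐ b ∂ν, MemLp (fun z => H (z, b)) 2 μ := by
  filter_upwards [hL.integrable_sq.prod_left_ae] with b hb
  exact (memLp_two_iff_integrable_sq
    (hH.comp measurable_prodMk_right).aestronglyMeasurable).2 hb

/-- By Jensen, the squared section mean is at most the section's second moment, which is integrable
by Fubini. -/
lemma memLp_integral_section (hH : Measurable H) (hL : MemLp H 2 (μ.prod ν)) :
    MemLp (fun b => ∫ z, H (z, b) ∂μ) 2 ν := by
  have hi : Integrable H (μ.prod ν) := hL.integrable one_le_two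
  have hm : AEStronglyMeasurable (fun b => ∫ z, H (z, b) ∂μ) ν :=
    hi.integral_prod_right.aestronglyMeasurable
  refine (memLp_two_iff_integrable_sq hm).2
    (hL.integrable_sq.integral_prod_right.mono' (hm.pow 2) ?_)
  filter_upwards [ae_memLp_section hH hL] with b hb
  rw [Real.norm_eq_abs, abs_of_nonneg (sq_nonneg _)]
  exact sq_integral_le_integral_sq hb

lemma integrable_meanVar_section (s γ : ℝ) (hH : Measurable H) (hL : MemLp H 2 (μ.prod ν)) :
    Integrable (fun b => meanVar s γ μ fun z => H (z, b)) ν := by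
  have h1 := memLp_integral_section hH hL
  have h : Integrable (fun b => s * ∫ z, H (z, b) ∂μ
      - γ * s ^ 2 * (∫ z, H (z, b) ^ 2 ∂μ - (∫ z, H (z, b) ∂μ) ^ 2)) ν :=
    ((h1.integrable one_le_two).const_mul _).sub
      ((hL.integrable_sq.integral_prod_right.sub h1.integrable_sq).const_mul _)
  refine h.congr ?_
  filter_upwards [ae_memLp_section hH hL] with b hb
  rw [meanVar_eq hb]

/-- Freezing an independent source of randomness does not decrease the criterion on average. -/
lemma meanVar_prod_le {s γ : ℝ} (hγ : 0 ≤ γ) (hH : Measurable H) (hL : MemLp H 2 (μ.prod ν)) :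
    meanVar s γ (μ.prod ν) H ≤ ∫ b, meanVar s γ μ (fun z => H (z, b)) ∂ν := by
  have h1 := memLp_integral_section hH hL
  have hi : Integrable H (μ.prod ν) := hL.integrable one_le_two
  have hae : (fun b => meanVar s γ μ fun z => H (z, b)) =ᵐ[ν] fun b => s * ∫ z, H (z, b) ∂μ
      - γ * s ^ 2 * (∫ z, H (z, b) ^ 2 ∂μ - (∫ z, H (z, b) ∂μ) ^ 2) := by
    filter_upwards [ae_memLp_section hH hL] with b hb
    rw [meanVar_eq hb]
  have hd : Integrable
      (fun b => γ * s ^ 2 * (∫ z, H (z, b) ^ 2 ∂μ - (∫ z, H (z, b) ∂μ) ^ 2)) ν :=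
    (hL.integrable_sq.integral_prod_right.sub h1.integrable_sq).const_mul _
  rw [integral_congr_ae hae, integral_sub ((h1.integrable one_le_two).const_mul _) hd,
    integral_const_mul, integral_const_mul,
    integral_sub hL.integrable_sq.integral_prod_right h1.integrable_sq, meanVar_eq hL,
    integral_prod_symm _ hi, integral_prod_symm _ hL.integrable_sq]
  -- First and second moments agree on both sides; only the squared means differ, and Jensen for the
  -- section means orders them.
  have := sq_integral_le_integral_sq h1
  have hc : 0 ≤ γ * s ^ 2 := by positivity
  nlinarith [mul_le_mul_of_nonneg_left this hc]

end MeanVariance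

/-! ### Coarse controls obtained by freezing the bridges. -/

namespace Market

variable {Ω : Type*} {d N : ℕ}

lemma IsControl.mono {p : ℕ} {𝓗 𝓗' : ℕ → MeasurableSpace Ω} (h : ∀ n, 𝓗 n ≤ 𝓗' n)
    {α : ℕ → Ω → (Fin d → ℝ)} (hα : IsControl N p 𝓗 α) : IsControl N p 𝓗' α where
  start_zero := hα.start_zero
  predictable n h1 hn := (hα.predictable n h1 hn).mono (h _) le_rfl
  no_trade := hα.no_trade

lemma exists_eq_comp_fineIncr {M : Market d N} {W : ℝ≥0 → Ω → (Fin d → ℝ)} {p : ℕ}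
    {α : ℕ → Ω → (Fin d → ℝ)} (hα : IsControl N p (M.fineFiltration W) α) :
    ∃ h : ∀ n, (Fin n → Fin d → ℝ) → (Fin d → ℝ), (∀ n, Measurable (h n)) ∧
      ∀ n < N, ∀ ω, α (n + 1) ω = h n fun k => M.fineIncr W k ω := by
  have key : ∀ n, ∃ h : (Fin n → Fin d → ℝ) → (Fin d → ℝ), Measurable h ∧
      (n < N → ∀ ω, α (n + 1) ω = h fun k => M.fineIncr W k ω) := by
    intro n
    by_cases hn : n < N
    · have hm := hα.predictable (n + 1) (by omega) hn
      rw [Nat.add_sub_cancel, comap_fineIncr_eq] at hm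
      obtain ⟨h, hh, he⟩ := hm.exists_eq_measurable_comp
      exact ⟨h, hh, fun _ ω => congrFun he ω⟩
    · exact ⟨fun _ => 0, measurable_const, fun h => absurd h hn⟩
  choose h hh he using key
  exact ⟨h, hh, he⟩

/-- The control with feedback functions `h`, driven by the coarse increments `z`, with the bridge
part of the fine increments frozen at `b`. -/
def frozenControl (N p : ℕ) (c : ℕ → ℝ) (h : ∀ n, (Fin n → Fin d → ℝ) → (Fin d → ℝ))
    (z b : ℕ → Fin d → ℝ) : ℕ → Fin d → ℝ
  | 0 => 0
  -- The feedback is taken at the block start `n / p * p`, so positions stay constant within a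
  -- block.
  | n + 1 => if n < N then h (n / p * p) fun k => b k + c k • z (k / p) else 0

lemma measurable_frozenControl (N p : ℕ) (c : ℕ → ℝ)
    {h : ∀ n, (Fin n → Fin d → ℝ) → (Fin d → ℝ)} (hh : ∀ n, Measurable (h n)) :
    Measurable fun q : (ℕ → Fin d → ℝ) × (ℕ → Fin d → ℝ) =>
      frozenControl N p c h q.1 q.2 := by
  refine measurable_pi_lambda _ fun n => ?_
  cases n with
  | zero => exact measurable_const
  | succ n =>
    simp only [frozenControl]
    split_ifs
    · have := hh (n / p * p)
      fun_prop
    · exact measurable_const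

lemma isControl_frozenControl (M : Market d N) (W : ℝ≥0 → Ω → (Fin d → ℝ)) {p K : ℕ}
    (hK : N = K * p) (c : ℕ → ℝ)
    {h : ∀ n, (Fin n → Fin d → ℝ) → (Fin d → ℝ)} (hh : ∀ n, Measurable (h n))
    {Z : Ω → ℕ → Fin d → ℝ} (hZ : ∀ ω, ∀ j < K, Z ω j = M.coarseIncr W p j ω)
    (b : ℕ → Fin d → ℝ) :
    IsControl N p (M.coarseFiltration W p) fun n ω => frozenControl N p c h (Z ω) b n where
  start_zero _ := rfl
  predictable n h1 hn := by
    obtain ⟨n, rfl⟩ := Nat.exists_eq_add_of_le' h1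
    simp only [frozenControl, if_pos (show n < N from hn)]
    let _ : MeasurableSpace Ω := M.coarseFiltration W p n
    refine (hh _).comp (measurable_pi_lambda _ fun k => ?_)
    -- Only fine steps before the current block are used, so each coarse increment involved is
    -- already complete; this gives coarse predictability.
    have hk : (k : ℕ) / p < n / p := Nat.div_lt_of_lt_mul (by simpa [mul_comm] using k.2)
    have hkK : (k : ℕ) / p < K :=
      hk.trans_le (Nat.div_le_of_le_mul (by rw [mul_comm, ← hK]; omega))
    simp only [fun ω => hZ ω _ hkK]
    exact ((M.measurable_coarseIncr W hk).const_smul (c k)).const_add (b k)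
  no_trade n h1 hn hd ω := by
    obtain ⟨n, rfl⟩ := Nat.exists_eq_add_of_le' h1
    simp only [frozenControl]
    rw [if_pos hn, if_pos (by omega), Nat.succ_div_of_not_dvd hd]

/-- Evaluating the feedback at the block start loses nothing, because `α` is itself constant on
blocks. -/
lemma frozenControl_eq {M : Market d N} {W : ℝ≥0 → Ω → (Fin d → ℝ)} {p : ℕ} (c : ℕ → ℝ)
    {h : ∀ n, (Fin n → Fin d → ℝ) → (Fin d → ℝ)} {α : ℕ → Ω → (Fin d → ℝ)}
    (hα : IsControl N p (M.fineFiltration W) α)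
    (hh : ∀ n < N, ∀ ω, α (n + 1) ω = h n fun k => M.fineIncr W k ω)
    {z b : ℕ → Fin d → ℝ} {ω : Ω} (hzb : ∀ k < N, M.fineIncr W k ω = b k + c k • z (k / p))
    {n : ℕ} (hn : n ≤ N) : frozenControl N p c h z b n = α n ω := by
  cases n with
  | zero => exact (hα.start_zero ω).symm
  | succ n =>
    have hle : n / p * p ≤ n := Nat.div_mul_le_self n p
    rw [eq_block_start hα.no_trade hn, hh _ (by omega)]
    simp only [frozenControl, if_pos (show n < N from hn)]
    congr 1
    funext k
    exact (hzb k (by omega)).symm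

variable [MeasurableSpace Ω] {P : Measure Ω}

lemma IsAdmissible.fine_of_coarse {M : Market d N} {W : ℝ≥0 → Ω → (Fin d → ℝ)} {V₀ ν : ℝ}
    {p : ℕ} {α : ℕ → Ω → (Fin d → ℝ)}
    (hα : M.IsAdmissible W P V₀ ν p (M.coarseFiltration W p) α) :
    M.IsAdmissible W P V₀ ν p (M.fineFiltration W) α :=
  ⟨hα.isControl.mono (M.coarseFiltration_le_fineFiltration W p), hα.memLp⟩

/-! ### Randomization by the bridges and its consequences for optimality. -/

variable [IsProbabilityMeasure P]

/-- The fine increments split into the coarse increments and an independent family of bridges. -/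
theorem exists_coarse_bridge_decomposition (M : Market d N) {W : ℝ≥0 → Ω → (Fin d → ℝ)}
    (hW : IsBrownianOn (M.t N) W P) {p K : ℕ} (hK : N = K * p) :
    ∃ (c : ℕ → ℝ) (Z B : Ω → ℕ → Fin d → ℝ), Measurable Z ∧ Measurable B ∧ IndepFun Z B P ∧
      (∀ ω, ∀ j < K, Z ω j = M.coarseIncr W p j ω) ∧
      ∀ ω, ∀ k < N, M.fineIncr W k ω = B ω k + c k • Z ω (k / p) := by
  have hblk : ∀ k : Fin N, (k : ℕ) / p < K := fun k =>
    Nat.div_lt_of_lt_mul (by have := k.2; rwa [mul_comm, ← hK])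
  let blk : Fin N → Fin K := fun k => ⟨k / p, hblk k⟩
  let v : Fin N → ℝ≥0 := fun k => M.t (k + 1) - M.t k
  let X : Fin N → Ω → Fin d → ℝ := fun k => M.fineIncr W k
  have hX : ∀ k, Measurable (X k) := fun k =>
    (hW.measurable _ (M.t_mono k.2 le_rfl)).sub (hW.measurable _ (M.t_mono k.2.le le_rfl))
  have hind : iIndepFun X P :=
    hW.indep_increments N (fun k => M.t k)
      (fun i j hij => M.t_mono hij (Nat.lt_succ_iff.1 j.2))
      fun k => M.t_mono (Nat.lt_succ_iff.1 k.2) le_rfl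
  have hlaw : ∀ k, P.map (X k) = Measure.pi fun _ => gaussianReal 0 (v k) := fun k =>
    hW.law_increment _ _ (M.t_lt k k.2).le (M.t_mono k.2 le_rfl)
  have hv : ∀ k, 0 < v k := fun k => tsub_pos_of_lt (M.t_lt k k.2)
  -- Padding by zero puts sums and bridges in one sequence space, whatever `K` and `N` are.
  let extend : (n : ℕ) → (Fin n × Fin d → ℝ) → ℕ → Fin d → ℝ := fun n f j i =>
    if h : j < n then f (⟨j, h⟩, i) else 0
  have hext : ∀ n, Measurable (extend n) := by
    intro n
    refine measurable_pi_lambda _ fun j => measurable_pi_lambda _ fun i => ?_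
    by_cases h : j < n
    · simp only [extend, dif_pos h]
      exact measurable_pi_apply _
    · simp only [extend, dif_neg h]
      exact measurable_const
  have hsplit := (blockSplit (δ := Fin d) blk fun k => (v k : ℝ)).toContinuousLinearMap.measurable
  have hXm : Measurable fun ω k => X k ω := measurable_pi_lambda _ hX
  let Z₀ : Ω → Fin K × Fin d → ℝ := fun ω => blockSum blk fun k => X k ω
  let B₀ : Ω → Fin N × Fin d → ℝ := fun ω => blockBridge blk (fun k => (v k : ℝ)) fun k => X k ω
  have hZ₀ : Measurable Z₀ := (measurable_fst.comp hsplit).comp hXm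
  have hB₀ : Measurable B₀ := (measurable_snd.comp hsplit).comp hXm
  have hZB : IndepFun Z₀ B₀ P := indepFun_blockSum_blockBridge hX hind hlaw hv blk
  refine ⟨fun k => if h : k < N then blockRatio blk (fun k => (v k : ℝ)) ⟨k, h⟩ else 0,
    fun ω => extend K (Z₀ ω), fun ω => extend N (B₀ ω), (hext K).comp hZ₀, (hext N).comp hB₀,
    hZB.comp (hext K) (hext N), fun ω j hj => ?_, fun ω k hk => ?_⟩
  · funext i
    simp only [extend, dif_pos hj, Z₀, blockSum, X, blk, coarseIncr_eq_sum, Finset.sum_apply,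
      Fin.ext_iff]
    rw [Fin.sum_univ_eq_sum_range (fun k => if k / p = j then M.fineIncr W k ω i else 0),
      ← Finset.sum_filter]
    refine Finset.sum_congr (Finset.ext fun k => ?_) fun _ _ => rfl
    have hjK : (j + 1) * p ≤ N := hK ▸ Nat.mul_le_mul_right p hj
    simp only [Finset.mem_filter, Finset.mem_range, Finset.mem_Ico]
    rcases Nat.eq_zero_or_pos p with rfl | hp
    -- Here `N = 0`, and both index sets are empty.
    · simp_all
    · rw [Nat.div_eq_iff hp, Nat.succ_mul]
      rw [Nat.succ_mul] at hjK
      omega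
  · funext i
    have hkK : k / p < K := hblk ⟨k, hk⟩
    simp only [extend, dif_pos hk, dif_pos hkK, B₀, blockBridge, Z₀, X, blk, Pi.add_apply,
      Pi.smul_apply, smul_eq_mul]
    ring

lemma objective_eq_meanVar (M : Market d N) (W : ℝ≥0 → Ω → (Fin d → ℝ)) (P : Measure Ω)
    (V₀ ν γ : ℝ) (α : ℕ → Ω → (Fin d → ℝ)) :
    M.objective W P V₀ ν γ α = meanVar (M.bond N) γ P (M.terminalWealth W V₀ ν α) := rfl

/-- An admissible fine control is a randomization, by the independent bridges `B`, of coarse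
controls driven by the coarse increments `Z`, whose criterion is on average at least as large. -/
theorem exists_coarse_randomization (M : Market d N) {W : ℝ≥0 → Ω → (Fin d → ℝ)}
    (hW : IsBrownianOn (M.t N) W P) {p K : ℕ} (hp : 0 < p) (hK : N = K * p) (V₀ ν : ℝ) {γ : ℝ}
    (hγ : 0 ≤ γ) {α : ℕ → Ω → (Fin d → ℝ)}
    (hα : M.IsAdmissible W P V₀ ν p (M.fineFiltration W) α) :
    ∃ (Z B : Ω → ℕ → Fin d → ℝ) (A : (ℕ → Fin d → ℝ) → (ℕ → Fin d → ℝ) → ℕ → Fin d → ℝ),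
      Measurable Z ∧ Measurable B ∧ IndepFun Z B P ∧ Measurable (fun q : _ × _ => A q.1 q.2) ∧
      (∀ ω, ∀ n ≤ N, A (Z ω) (B ω) n = α n ω) ∧
      (∀ᵐ b ∂P.map B,
        M.IsAdmissible W P V₀ ν p (M.coarseFiltration W p) fun n ω => A (Z ω) b n) ∧
      Integrable (fun b => M.objective W P V₀ ν γ fun n ω => A (Z ω) b n) (P.map B) ∧
      M.objective W P V₀ ν γ α
        ≤ ∫ b, M.objective W P V₀ ν γ (fun n ω => A (Z ω) b n) ∂P.map B := by
  obtain ⟨c, Z, B, hZm, hBm, hZB, hZ, hfine⟩ := M.exists_coarse_bridge_decomposition hW hK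
  obtain ⟨h, hh, hαh⟩ := exists_eq_comp_fineIncr hα.isControl
  have : IsProbabilityMeasure (P.map Z) := Measure.isProbabilityMeasure_map hZm.aemeasurable
  have : IsProbabilityMeasure (P.map B) := Measure.isProbabilityMeasure_map hBm.aemeasurable
  have hprod := (indepFun_iff_map_prod_eq_prod_map_map hZm.aemeasurable hBm.aemeasurable).1 hZB
  have hAm := measurable_frozenControl (d := d) N p c hh
  have hctl := isControl_frozenControl M W hK c hh hZ
  -- The bridges enter only through the positions, so each section of `H` is the terminal wealth of
  -- a frozen control.
  let H : (ℕ → Fin d → ℝ) × (ℕ → Fin d → ℝ) → ℝ := fun q =>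
    M.coarseWealth p V₀ ν K (frozenControl N p c h q.1 q.2) q.1
  have hHm : Measurable H := M.measurable_coarseWealth p V₀ ν K hAm measurable_fst
  have hagree : ∀ ω, ∀ n ≤ N, frozenControl N p c h (Z ω) (B ω) n = α n ω := fun ω n hn =>
    frozenControl_eq c hα.isControl hαh (hfine ω) hn
  have hTW : M.terminalWealth W V₀ ν α = fun ω => H (Z ω, B ω) := funext fun ω =>
    terminalWealth_eq_coarseWealth hp hK V₀ ν hα.isControl.no_trade ω (hagree ω) (hZ ω)
  have hTWb : ∀ b, M.terminalWealth W V₀ ν (fun n ω => frozenControl N p c h (Z ω) b n)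
      = fun ω => H (Z ω, b) := fun b => funext fun ω =>
    terminalWealth_eq_coarseWealth hp hK V₀ ν (hctl b).no_trade ω (fun _ _ => rfl) (hZ ω)
  have hpair : Measurable fun ω => (Z ω, B ω) := hZm.prodMk hBm
  have hL : MemLp H 2 ((P.map Z).prod (P.map B)) := by
    rw [← hprod, memLp_map_measure_iff hHm.aestronglyMeasurable hpair.aemeasurable]
    have hm := hα.memLp
    rwa [hTW] at hm
  have hJ : M.objective W P V₀ ν γ α
      = meanVar (M.bond N) γ ((P.map Z).prod (P.map B)) H := by
    rw [objective_eq_meanVar, hTW, ← hprod, meanVar_map hpair hHm]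
  have hJb : ∀ b, M.objective W P V₀ ν γ (fun n ω => frozenControl N p c h (Z ω) b n)
      = meanVar (M.bond N) γ (P.map Z) fun z => H (z, b) := fun b => by
    have hs : Measurable fun z => H (z, b) := hHm.comp measurable_prodMk_right
    rw [objective_eq_meanVar, hTWb, meanVar_map hZm hs]
  refine ⟨Z, B, frozenControl N p c h, hZm, hBm, hZB, hAm, hagree, ?_, ?_, ?_⟩
  · filter_upwards [ae_memLp_section hHm hL] with b hb
    refine ⟨hctl b, ?_⟩
    rw [hTWb]
    exact hb.comp_of_map hZm.aemeasurable
  · simpa only [hJb] using integrable_meanVar_section (M.bond N) γ hHm hL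
  · simpa only [hJb, hJ] using meanVar_prod_le hγ hHm hL

/-- Every admissible fine control is dominated by an admissible coarse control. -/
theorem exists_coarse_ge (M : Market d N) {W : ℝ≥0 → Ω → (Fin d → ℝ)}
    (hW : IsBrownianOn (M.t N) W P) {p K : ℕ} (hp : 0 < p) (hK : N = K * p) (V₀ ν : ℝ) {γ : ℝ}
    (hγ : 0 ≤ γ) {α : ℕ → Ω → (Fin d → ℝ)}
    (hα : M.IsAdmissible W P V₀ ν p (M.fineFiltration W) α) :
    ∃ β : ℕ → Ω → (Fin d → ℝ), M.IsAdmissible W P V₀ ν p (M.coarseFiltration W p) β ∧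
      M.objective W P V₀ ν γ α ≤ M.objective W P V₀ ν γ β := by
  obtain ⟨Z, B, A, -, hB, -, -, -, hadm, hint, hle⟩ :=
    M.exists_coarse_randomization hW hp hK V₀ ν hγ hα
  have : IsProbabilityMeasure (P.map B) := Measure.isProbabilityMeasure_map hB.aemeasurable
  -- Off the null set of inadmissible `b`, some value of the criterion reaches its average.
  obtain ⟨b, hb, hbJ⟩ := exists_notMem_null_integral_le hint (ae_iff.1 hadm)
  exact ⟨_, not_not.1 hb, hle.trans hbJ⟩

/-- If the `n`-th component of coarse solutions is unique, it is that of every fine solution. -/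
theorem IsSolution.ae_eq_coarse {M : Market d N} {W : ℝ≥0 → Ω → (Fin d → ℝ)}
    (hW : IsBrownianOn (M.t N) W P) {p K : ℕ} (hp : 0 < p) (hK : N = K * p) {V₀ ν γ : ℝ}
    (hγ : 0 ≤ γ) {α : ℕ → Ω → (Fin d → ℝ)} (hα : M.IsSolution W P V₀ ν γ p α) {n : ℕ}
    (h1 : 1 ≤ n) (hn : n ≤ N)
    (huniq : ∀ β β' : ℕ → Ω → (Fin d → ℝ),
      M.IsSolution W P V₀ ν γ p β →
      (∀ k, 1 ≤ k → k ≤ N → Measurable[M.coarseFiltration W p (k - 1)] (β k)) →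
      M.IsSolution W P V₀ ν γ p β' →
      (∀ k, 1 ≤ k → k ≤ N → Measurable[M.coarseFiltration W p (k - 1)] (β' k)) →
      β n =ᵐ[P] β' n) :
    ∃ g : Ω → (Fin d → ℝ), Measurable[M.coarseFiltration W p (n - 1)] g ∧ α n =ᵐ[P] g := by
  obtain ⟨Z, B, A, hZ, hB, hZB, hA, hagree, hadm, hint, hle⟩ :=
    M.exists_coarse_randomization hW hp hK V₀ ν hγ hα.admissible
  have : IsProbabilityMeasure (P.map Z) := Measure.isProbabilityMeasure_map hZ.aemeasurable
  have : IsProbabilityMeasure (P.map B) := Measure.isProbabilityMeasure_map hB.aemeasurable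
  have hbound : (fun b => M.objective W P V₀ ν γ fun n ω => A (Z ω) b n)
      ≤ᵐ[P.map B] fun _ => M.objective W P V₀ ν γ α := by
    filter_upwards [hadm] with b hb using hα.optimal _ hb.fine_of_coarse
  -- A function bounded above by a constant, with average at least that constant, equals it almost
  -- everywhere.
  have heq : (fun b => M.objective W P V₀ ν γ fun n ω => A (Z ω) b n)
      =ᵐ[P.map B] fun _ => M.objective W P V₀ ν γ α :=
    (integral_eq_iff_of_ae_le hint (integrable_const _) hbound).1
      ((integral_mono_ae hint (integrable_const _) hbound).antisymm (by simpa using hle))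
  have hsol : ∀ᵐ b ∂P.map B, M.IsSolution W P V₀ ν γ p (fun n ω => A (Z ω) b n) ∧
      ∀ k, 1 ≤ k → k ≤ N →
        Measurable[M.coarseFiltration W p (k - 1)] (fun ω => A (Z ω) b k) := by
    filter_upwards [hadm, heq] with b hb hbJ
    exact ⟨⟨hb.fine_of_coarse, fun β hβ => (hα.optimal β hβ).trans_eq hbJ.symm⟩,
      hb.isControl.predictable⟩
  obtain ⟨b₀, hb₀, hb₀m⟩ := hsol.exists
  refine ⟨fun ω => A (Z ω) b₀ n, hb₀m n h1 hn, ?_⟩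
  have hAn : Measurable fun q : (ℕ → Fin d → ℝ) × (ℕ → Fin d → ℝ) => A q.1 q.2 n :=
    (measurable_pi_apply n).comp hA
  have hAn₀ : Measurable fun q : (ℕ → Fin d → ℝ) × (ℕ → Fin d → ℝ) => A q.1 b₀ n :=
    hAn.comp (measurable_fst.prodMk measurable_const)
  have hset : MeasurableSet
      {q : (ℕ → Fin d → ℝ) × (ℕ → Fin d → ℝ) | A q.2 q.1 n = A q.2 b₀ n} :=
    measurableSet_eq_fun (hAn.comp measurable_swap) (hAn₀.comp measurable_swap)
  -- Fubini with `b` as the outer variable: for almost every `b`, uniqueness compares two coarse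
  -- solutions, those frozen at `b` and at `b₀`.
  have hswap : ∀ᵐ q ∂(P.map B).prod (P.map Z), A q.2 q.1 n = A q.2 b₀ n := by
    rw [Measure.ae_prod_iff_ae_ae hset]
    filter_upwards [hsol] with b hb
    have hsec : MeasurableSet {z | A z b n = A z b₀ n} := hset.preimage measurable_prodMk_left
    rw [ae_map_iff hZ.aemeasurable hsec]
    exact huniq _ _ hb.1 hb.2 hb₀ hb₀m
  -- By independence the product law is that of `(B, Z)`, so the frozen `b` may be replaced by the
  -- actual bridge `B ω`, which recovers `α`.
  rw [← (indepFun_iff_map_prod_eq_prod_map_map hB.aemeasurable hZ.aemeasurable).1 hZB.symm,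
    ae_map_iff (hB.prodMk hZ).aemeasurable hset] at hswap
  filter_upwards [hswap] with ω hω
  rw [← hagree ω n hn]
  exact hω

end Market

end MeanVarCosts

end

theorem mainTheorem12 {Ω : Type*} [MeasurableSpace Ω] (P : Measure Ω) [IsProbabilityMeasure P]
    {d N : ℕ} (M : MeanVarCosts.Market d N) (p : ℕ) (hN : 0 < N) (hp : p ∣ N)
    (W : ℝ≥0 → Ω → (Fin d → ℝ)) (hW : MeanVarCosts.IsBrownianOn (M.t N) W P)
    (V₀ ν γ : ℝ) (hV₀ : 0 < V₀) (hν : 0 ≤ ν) (hγ : 0 < γ) :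
    (∀ α : ℕ → Ω → (Fin d → ℝ), M.IsAdmissible W P V₀ ν p (M.fineFiltration W) α →
      ∃ β : ℕ → Ω → (Fin d → ℝ), M.IsAdmissible W P V₀ ν p (M.coarseFiltration W p) β ∧
        M.objective W P V₀ ν γ α ≤ M.objective W P V₀ ν γ β) ∧
    (∀ α : ℕ → Ω → (Fin d → ℝ), M.IsSolution W P V₀ ν γ p α →
      (∃ β : ℕ → Ω → (Fin d → ℝ), M.IsSolution W P V₀ ν γ p β ∧
        ∀ n, 1 ≤ n → n ≤ N → Measurable[M.coarseFiltration W p (n - 1)] (β n)) ∧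
      (∀ n, 1 ≤ n → n ≤ N →
        (∀ β β' : ℕ → Ω → (Fin d → ℝ),
          M.IsSolution W P V₀ ν γ p β →
          (∀ k, 1 ≤ k → k ≤ N → Measurable[M.coarseFiltration W p (k - 1)] (β k)) →
          M.IsSolution W P V₀ ν γ p β' →
          (∀ k, 1 ≤ k → k ≤ N → Measurable[M.coarseFiltration W p (k - 1)] (β' k)) →
          β n =ᵐ[P] β' n) →
        ∃ g : Ω → (Fin d → ℝ), Measurable[M.coarseFiltration W p (n - 1)] g ∧
          α n =ᵐ[P] g)) := by
  obtain ⟨K, hK⟩ := hp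
  have hK : N = K * p := by rw [hK, mul_comm]
  have hp : 0 < p := Nat.pos_of_mul_pos_left (hK ▸ hN)
  refine ⟨fun α hα => M.exists_coarse_ge hW hp hK V₀ ν hγ.le hα, fun α hα => ⟨?_, ?_⟩⟩
  -- A coarse control that dominates a solution is itself a solution.
  · obtain ⟨β, hβ, hle⟩ := M.exists_coarse_ge hW hp hK V₀ ν hγ.le hα.admissible
    exact ⟨β, ⟨hβ.fine_of_coarse, fun β' hβ' => (hα.optimal β' hβ').trans hle⟩,
      hβ.isControl.predictable⟩
  · exact fun n h1 hn huniq => hα.ae_eq_coarse hW hp hK hγ.le h1 hn huniq
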